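/- Let $\Omega$ be a finite set of items and $\mathcal B$ a finite set of bidders; bidder $b$ has a valuation $v_b:2^\Omega\to\mathbb R$ with $v_b(\emptyset)=0$ that is monotone ($S\subseteq T$ implies $v_b(S)\le v_b(T)$). For a price vector $p\in\mathbb R_{\ge0}^\Omega$ write $p(T)=\sum_{j\in T}p_j$. For a valuation $w$ and $S\subseteq\Omega$, the demand of $w$ on $S$ at prices $p$ is the family of all $T\subseteq S$ that maximize $w(T)-p(T)$ among the subsets of $S$; the demand $D_w(p)$ is the demand on $\Omega$. The valuation $w$ is gross substitute if for all price vectors $p^{(2)}\ge p^{(1)}\ge 0$ and every $D^{(1)}\in D_w(p^{(1)})$ there is $D^{(2)}\in D_w(p^{(2)})$ that contains every $j\in D^{(1)}$ with $p^{(1)}_j=p^{(2)}_j$. An allocation of $S$ is a family $\langle S_b\rangle_{b\in\mathcal B}$ of pairwise disjoint subsets of $S$ (items may stay unallocated). It is envy free on $S$ for prices $p$ if each $S_b$ is in the demand of $v_b$ on $S$ at $p$; prices are envy free on $S$ if they admit an envy-free allocation on $S$. An envy-free (EF) mediator for $\mathcal B$ works as follows. For central prices $r\ge0$ and each $S\subseteq\Omega$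 she runs a virtual auction. Its outcome consists of prices $p^S\ge r$ on $S$ that are item-wise minimal among the prices $\ge r$ that are envy free on $S$, extended by $p^S_j=r_j$ for $j\in\Omega\setminus S$, and of an allocation $\langle S_b\rangle$ that is envy free on $S$ for $p^S$ and, among all such allocations, maximizes $\sum_b p^S(S_b)$. (If several outcomes are possible, the mediator uses an arbitrary fixed choice.) Her revenue for $S$ is $R_r(S)=\sum_b p^S(S_b)-r(S)$ if $\langle S_b\rangle$ is envy free on $\Omega$ for $p^S$, and $R_r(S)=-1$ otherwise. Her demand at $r$ is the family of sets $S\subseteq\Omega$ that maximize $R_r(S)$. The OR-player for $\mathcal B$ has the valuation $v_{\mathrm{OR}}(S)=\max\sum_{b}v_b(S_b)$, where the maximum is over all allocations $\langle S_b\rangle$ of $S$; an optimal OR-player allocation for $S$ is one that attains this maximum. **Theorem.** Suppose that every $v_b$, $b\in\mathcal B$, is gross substitute. Then for every EF mediator for $\mathcal B$ and all central prices $r\ge0$, the demand of the mediator at $r$ equals the demand of the OR-player at $r$. Moreover, for every set $S$ in this demand, the allocation in the mediator's virtual auction for $S$ and $r$ is an optimal OR-player allocation for $S$. Conversely, every optimal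 OR-player allocation $\langle S_b\rangle$ for $S$ can be used by the mediator in her virtual auction for $S$ and $r$: together with her virtual auction prices $p^S$ it is an outcome of that virtual auction, it is envy free on $\Omega$ for $p^S$, and it gives her the same revenue $\sum_b p^S(S_b)-r(S)=R_r(S)$, which is maximal. -/

import Mathlib

open scoped BigOperators

namespace AdExchange

section

variable {I B : Type*} [Fintype I] [Fintype B]

/-- Quasi-linear utility of the set `T` at prices `p`, for the valuation `w`. -/
def utility (w : Finset I → ℝ) (p : I → ℝ) (T : Finset I) : ℝ :=
  w T - ∑ j ∈ T, p j

/-- The demand at prices `p` when only the items in `S` are on offer: the subsets of `S` of maximum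
utility among all subsets of `S`. -/
def demandOn (w : Finset I → ℝ) (S : Finset I) (p : I → ℝ) : Set (Finset I) :=
  {T | T ⊆ S ∧ ∀ U ⊆ S, utility w p U ≤ utility w p T}

/-- The demand at prices `p`, over all items. -/
def demand (w : Finset I → ℝ) (p : I → ℝ) : Set (Finset I) :=
  demandOn w Finset.univ p

/-- Gross-substitute valuations. -/
def GrossSubstitute (w : Finset I → ℝ) : Prop :=
  ∀ p₁ p₂ : I → ℝ, 0 ≤ p₁ → p₁ ≤ p₂ → ∀ D₁ ∈ demand w p₁,
    ∃ D₂ ∈ demand w p₂, ∀ j ∈ D₁, p₁ j = p₂ j → j ∈ D₂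

/-- An allocation of items of `S` to the bidders; items may stay unallocated. -/
def IsAllocation (S : Finset I) (A : B → Finset I) : Prop :=
  (∀ b, A b ⊆ S) ∧ ∀ b c, b ≠ c → Disjoint (A b) (A c)

/-- The allocation `A` is envy free on the item set `S` for the prices `p`. -/
def EnvyFree (v : B → Finset I → ℝ) (S : Finset I) (p : I → ℝ) (A : B → Finset I) : Prop :=
  IsAllocation S A ∧ ∀ b, A b ∈ demandOn (v b) S p

/-- The prices `p` are envy free on the item set `S`. -/
def EnvyFreePrices (v : B → Finset I → ℝ) (S : Finset I) (p : I → ℝ) : Prop :=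
  ∃ A : B → Finset I, EnvyFree v S p A

/-- Prices that are candidates for the virtual auction on `S` with reserve prices `r`: envy free
on `S`, at least `r`, and extended by `r` to the items outside `S`. -/
def IsReserveEnvyFreePrice (v : B → Finset I → ℝ) (r : I → ℝ) (S : Finset I) (p : I → ℝ) : Prop :=
  r ≤ p ∧ (∀ j, j ∉ S → p j = r j) ∧ EnvyFreePrices v S p

/-- `(p, A)` is a possible outcome of the virtual auction with items `S` and reserve prices `r`. -/
structure IsVirtualAuctionOutcome (v : B → Finset I → ℝ) (r : I → ℝ) (S : Finset I)
    (p : I → ℝ) (A : B → Finset I) : Prop where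
  /-- The prices are (item-wise) minimal among the envy-free prices on `S` that respect `r`. -/
  minimal_price : Minimal (IsReserveEnvyFreePrice v r S) p
  /-- The allocation is envy free on `S` for these prices. -/
  envyFree : EnvyFree v S p A
  /-- Among the envy-free allocations on `S` for these prices it has the largest total payment. -/
  max_payment : ∀ A' : B → Finset I, EnvyFree v S p A' →
    ∑ b, ∑ j ∈ A' b, p j ≤ ∑ b, ∑ j ∈ A b, p j

open Classical in
/-- The revenue of a mediator from the set `S`, bought at prices `r`, when her virtual auction for
`S` has the outcome `(p, A)`. -/
noncomputable def outcomeRevenue (v : B → Finset I → ℝ) (r : I → ℝ) (S : Finset I)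
    (p : I → ℝ) (A : B → Finset I) : ℝ :=
  if EnvyFree v Finset.univ p A then (∑ b, ∑ j ∈ A b, p j) - ∑ j ∈ S, r j else -1

/-- An envy-free mediator for bidders with valuations `v`. Minimal envy-free prices and envy-free
allocations need not be unique, so a mediator is a selection of one outcome of the virtual auction
for all reserve prices `r ≥ 0` and item sets `S` (the values at other `r` are irrelevant). -/
structure EFMediator (v : B → Finset I → ℝ) where
  /-- The virtual auction prices. -/
  price : (I → ℝ) → Finset I → I → ℝ
  /-- The virtual auction allocation. -/
  alloc : (I → ℝ) → Finset I → B → Finset I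
  /-- For nonnegative reserve prices they form an outcome of the virtual auction. -/
  isOutcome : ∀ r : I → ℝ, 0 ≤ r → ∀ S : Finset I,
    IsVirtualAuctionOutcome v r S (price r S) (alloc r S)

/-- The revenue of the mediator for the set `S` at central prices `r`. -/
noncomputable def EFMediator.revenue {v : B → Finset I → ℝ} (M : EFMediator v) (r : I → ℝ)
    (S : Finset I) : ℝ :=
  outcomeRevenue v r S (M.price r S) (M.alloc r S)

/-- The demand of the mediator at central prices `r`. -/
def EFMediator.demand {v : B → Finset I → ℝ} (M : EFMediator v) (r : I → ℝ) : Set (Finset I) :=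
  {S | ∀ T : Finset I, M.revenue r T ≤ M.revenue r S}

/-- The valuation of the OR-player: the maximum total value of an allocation of items of `S`. -/
noncomputable def orValuation (v : B → Finset I → ℝ) (S : Finset I) : ℝ :=
  sSup {x | ∃ A : B → Finset I, IsAllocation S A ∧ x = ∑ b, v b (A b)}

/-- `A` is an optimal allocation of the items of `S` for the OR-player. -/
def IsOptimalORAllocation (v : B → Finset I → ℝ) (S : Finset I) (A : B → Finset I) : Prop :=
  IsAllocation S A ∧ ∑ b, v b (A b) = orValuation v S

/-- The supremum in `orValuation` is a maximum. -/
theorem isGreatest_orValuation (v : B → Finset I → ℝ) (S : Finset I) :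
    IsGreatest {x | ∃ A : B → Finset I, IsAllocation S A ∧ x = ∑ b, v b (A b)}
      (orValuation v S) := by
  have hfin : {x | ∃ A : B → Finset I, IsAllocation S A ∧ x = ∑ b, v b (A b)}.Finite :=
    (Set.finite_range fun A : B → Finset I => ∑ b, v b (A b)).subset (by
      rintro x ⟨A, -, rfl⟩
      exact ⟨A, rfl⟩)
  have hne : {x | ∃ A : B → Finset I, IsAllocation S A ∧ x = ∑ b, v b (A b)}.Nonempty :=
    ⟨_, fun _ => ∅, ⟨fun _ => Finset.empty_subset _, fun _ _ _ => Finset.disjoint_empty_left _⟩,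
      rfl⟩
  exact ⟨hne.csSup_mem hfin, fun x hx => le_csSup hfin.bddAbove hx⟩

theorem isClosed_envyFreePrices (v : B → Finset I → ℝ) (S : Finset I) :
    IsClosed {p : I → ℝ | EnvyFreePrices v S p} := by
  have h : {p : I → ℝ | EnvyFreePrices v S p} =
      ⋃ A : B → Finset I, {p : I → ℝ | EnvyFree v S p A} := by
    ext p; simp [EnvyFreePrices]
  rw [h]
  refine isClosed_iUnion_of_finite fun A => ?_
  change IsClosed {p : I → ℝ | IsAllocation S A ∧ ∀ b, A b ⊆ S ∧ ∀ U, U ⊆ S →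
    v b U - ∑ j ∈ U, p j ≤ v b (A b) - ∑ j ∈ A b, p j}
  simp only [Set.ofPred_and, Set.ofPred_forall]
  refine IsClosed.inter isClosed_const (isClosed_iInter fun b => ?_)
  refine IsClosed.inter isClosed_const (isClosed_iInter fun U => isClosed_iInter fun _ => ?_)
  exact isClosed_le (by fun_prop) (by fun_prop)

/-- The virtual auction has an outcome for all reserve prices and item sets. -/
theorem exists_virtualAuctionOutcome (v : B → Finset I → ℝ) (h0 : ∀ b, v b ∅ = 0)
    (r : I → ℝ) (hr : 0 ≤ r) (S : Finset I) :
    ∃ (p : I → ℝ) (A : B → Finset I), IsVirtualAuctionOutcome v r S p A := by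
  classical
  obtain ⟨V, hV0, hV⟩ : ∃ V : ℝ, 0 ≤ V ∧ ∀ b U, v b U ≤ V := by
    refine ⟨∑ b, ∑ U, |v b U|, by positivity, fun b U => ?_⟩
    calc v b U ≤ |v b U| := le_abs_self _
      _ ≤ ∑ U, |v b U| :=
        Finset.single_le_sum (f := fun U => |v b U|) (fun _ _ => abs_nonneg _) (Finset.mem_univ U)
      _ ≤ ∑ b, ∑ U, |v b U| :=
        Finset.single_le_sum (f := fun b => ∑ U, |v b U|)
          (fun _ _ => Finset.sum_nonneg fun _ _ => abs_nonneg _) (Finset.mem_univ b)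
  let q : I → ℝ := fun j => if j ∈ S then r j + V else r j
  have hrq : r ≤ q := fun j => by
    by_cases hj : j ∈ S <;> simp [q, hj, hV0]
  have hq : IsReserveEnvyFreePrice v r S q := by
    refine ⟨hrq, fun j hj => by simp [q, hj], fun _ => ∅,
      ⟨fun _ => Finset.empty_subset _, fun _ _ _ => Finset.disjoint_empty_left _⟩, fun b =>
      ⟨Finset.empty_subset _, fun U hU => ?_⟩⟩
    simp only [utility, h0, Finset.sum_empty, sub_zero]
    rcases U.eq_empty_or_nonempty with rfl | ⟨j, hj⟩
    · simp [h0]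
    · have h1 : q j ≤ ∑ j ∈ U, q j :=
        Finset.single_le_sum (f := q) (fun i _ => (hr i).trans (hrq i)) hj
      have h2 : q j = r j + V := by simp [q, hU hj]
      have h3 : 0 ≤ r j := hr j
      linarith [hV b U]
  have hclosed : IsClosed {p | IsReserveEnvyFreePrice v r S p} := by
    simp only [IsReserveEnvyFreePrice, Set.ofPred_and, Set.ofPred_forall]
    refine IsClosed.inter (isClosed_le continuous_const continuous_id) (IsClosed.inter ?_
      (isClosed_envyFreePrices v S))
    exact isClosed_iInter fun j => isClosed_iInter fun _ =>
      isClosed_eq (continuous_apply j) continuous_const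
  obtain ⟨p, ⟨hp, hpq⟩, hmin⟩ :=
    ((isCompact_Icc (a := r) (b := q)).inter_left hclosed).exists_isMinOn
      (f := fun p : I → ℝ => ∑ j, p j) ⟨q, hq, hrq, le_rfl⟩ (by fun_prop)
  have hpmin : Minimal (IsReserveEnvyFreePrice v r S) p := by
    refine ⟨hp, fun p' hp' hle => ?_⟩
    have h1 : ∑ j, p j ≤ ∑ j, p' j := hmin ⟨hp', hp'.1, hle.trans hpq.2⟩
    have h2 := (Finset.sum_eq_sum_iff_of_le fun j _ => hle j).1
      (le_antisymm (Finset.sum_le_sum fun j _ => hle j) h1)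
    exact fun j => (h2 j (Finset.mem_univ j)).ge
  obtain ⟨A, hA, hmax⟩ := Set.exists_max_image {A : B → Finset I | EnvyFree v S p A}
    (fun A => ∑ b, ∑ j ∈ A b, p j) (Set.toFinite _) hp.2.2
  exact ⟨p, A, hpmin, hA, hmax⟩

/-- Envy-free mediators exist for all valuations with `v b ∅ = 0`. -/
theorem nonempty_efMediator (v : B → Finset I → ℝ) (h0 : ∀ b, v b ∅ = 0) :
    Nonempty (EFMediator v) := by
  classical
  have h : ∀ (r : I → ℝ) (S : Finset I), ∃ o : (I → ℝ) × (B → Finset I),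
      0 ≤ r → IsVirtualAuctionOutcome v r S o.1 o.2 := by
    intro r S
    by_cases hr : 0 ≤ r
    · obtain ⟨p, A, h⟩ := exists_virtualAuctionOutcome v h0 r hr S
      exact ⟨(p, A), fun _ => h⟩
    · exact ⟨(r, fun _ => ∅), fun h => absurd h hr⟩
  choose o ho using h
  exact ⟨⟨fun r S => (o r S).1, fun r S => (o r S).2, fun r hr S => ho r S hr⟩⟩

end

end AdExchange

namespace AdExchange

section

variable {I B : Type*}

/-! ### Indirect utility -/

/-! Let `q` be the least envy-free prices for all items above `r`, and let `U` be the bidders' total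
indirect utility at `q`. An allocation that is envy free on all items for `q` has payment equal to
its welfare minus `U`. So once the virtual prices are `q`, the mediator's revenue is OR-utility
minus the constant `U`, and maximizing payment is the same as maximizing welfare.

It remains to see that the prices are `q` for every relevant `S`. If `S` is in the OR-demand, the
welfare theorems make `q` support an optimal allocation inside `S`, and
`eq_of_minimal_of_isWalrasian` gives price `q`. If the virtual allocation for `S` is envy free on
all items, `eq_of_isVirtualAuctionOutcome` also gives `q`; for every other `S` the revenue is -1.
Thus revenue never exceeds OR-utility minus `U` unless it is -1. On the OR-demand this bound is
attained and is nonnegative, so the two families of maximizers agree.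

Gross substitutability enters twice. It makes the indirect utility submodular in prices, so that the
meet of Walrasian and envy-free prices is Walrasian (`IsWalrasian.inf`), and it drives the ascending
auction that yields a Walrasian equilibrium. Together these make minimal envy-free prices Walrasian
and least. -/

/-- The indirect utility: the largest utility of a set of items at prices `p`. -/
noncomputable def maxUtility [Fintype I] (w : Finset I → ℝ) (p : I → ℝ) : ℝ :=
  Finset.univ.sup' Finset.univ_nonempty (utility w p)

theorem utility_le_maxUtility [Fintype I] (w : Finset I → ℝ) (p : I → ℝ) (T : Finset I) :
    utility w p T ≤ maxUtility w p :=
  Finset.le_sup' (utility w p) (Finset.mem_univ T)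

theorem exists_utility_eq_maxUtility [Fintype I] (w : Finset I → ℝ) (p : I → ℝ) :
    ∃ T, utility w p T = maxUtility w p := by
  obtain ⟨T, -, hT⟩ := Finset.exists_mem_eq_sup' Finset.univ_nonempty (utility w p)
  exact ⟨T, hT.symm⟩

theorem maxUtility_le [Fintype I] {w : Finset I → ℝ} {p : I → ℝ} {x : ℝ} (h : ∀ T, utility w p T ≤ x) :
    maxUtility w p ≤ x :=
  Finset.sup'_le _ _ fun T _ => h T

theorem mem_demand [Fintype I] {w : Finset I → ℝ} {p : I → ℝ} {T : Finset I} :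
    T ∈ demand w p ↔ ∀ U, utility w p U ≤ utility w p T :=
  ⟨fun h U => h.2 U (Finset.subset_univ U), fun h => ⟨Finset.subset_univ T, fun U _ => h U⟩⟩

theorem mem_demand_iff_eq_maxUtility [Fintype I] {w : Finset I → ℝ} {p : I → ℝ} {T : Finset I} :
    T ∈ demand w p ↔ utility w p T = maxUtility w p := by
  rw [mem_demand]
  exact ⟨fun h => le_antisymm (utility_le_maxUtility w p T) (maxUtility_le h),
    fun h U => h ▸ utility_le_maxUtility w p U⟩

theorem utility_add_single [DecidableEq I] (w : Finset I → ℝ) (p : I → ℝ) (j : I) (t : ℝ)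
    (T : Finset I) :
    utility w (p + Pi.single j t) T = utility w p T - if j ∈ T then t else 0 := by
  simp only [utility, Pi.add_apply, Finset.sum_add_distrib]
  have h : ∑ i ∈ T, (Pi.single j t : I → ℝ) i = if j ∈ T then t else 0 := by
    simp [Pi.single_apply]
  rw [h]
  ring

/-- Let `s` be the loss of indirect utility at `m` when `j` becomes dearer by `t`. If only `s` is
added, a demanded set containing `j` is still optimal. Gross substitutability then gives a demanded
set containing `j` at `q` plus the same increase, so the loss at `q` is at least `s`. -/
theorem GrossSubstitute.maxUtility_add_single_le [Fintype I] [DecidableEq I] {w : Finset I → ℝ}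
    (hw : GrossSubstitute w) {m q : I → ℝ} (hm : 0 ≤ m) (hmq : m ≤ q) {j : I} {t : ℝ}
    (ht : 0 ≤ t) (hj : t = 0 ∨ m j = q j) :
    maxUtility w (q + Pi.single j t) + maxUtility w m ≤
      maxUtility w (m + Pi.single j t) + maxUtility w q := by
  have hanti : ∀ p : I → ℝ, maxUtility w (p + Pi.single j t) ≤ maxUtility w p := fun p =>
    maxUtility_le fun U => by
      have := utility_le_maxUtility w p U
      rw [utility_add_single]
      split_ifs <;> linarith
  have hlip : maxUtility w m ≤ maxUtility w (m + Pi.single j t) + t := maxUtility_le fun U => by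
    have := utility_le_maxUtility w (m + Pi.single j t) U
    rw [utility_add_single] at this
    split_ifs at this <;> linarith
  obtain ⟨s, hs⟩ : ∃ s, s = maxUtility w m - maxUtility w (m + Pi.single j t) := ⟨_, rfl⟩
  have hs0 : 0 ≤ s := by linarith [hanti m]
  have hst : s ≤ t := by linarith
  rcases hs0.eq_or_lt with h0 | h0
  · linarith [hanti q]
  have hjq : m j = q j := hj.resolve_left (by linarith)
  obtain ⟨T, hT⟩ := exists_utility_eq_maxUtility w m
  have hjT : j ∈ T := by
    by_contra hjT
    have := utility_le_maxUtility w (m + Pi.single j t) T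
    rw [utility_add_single, if_neg hjT] at this
    linarith
  have hTs : T ∈ demand w (m + Pi.single j s) := mem_demand.2 fun U => by
    rw [utility_add_single, utility_add_single, if_pos hjT]
    split_ifs with hU
    · linarith [utility_le_maxUtility w m U]
    · have := utility_le_maxUtility w (m + Pi.single j t) U
      rw [utility_add_single, if_neg hU] at this
      linarith
  have hsingle : (0 : I → ℝ) ≤ Pi.single j s := Pi.single_nonneg.2 hs0
  obtain ⟨D, hD, hjD⟩ := hw _ _ (add_nonneg hm hsingle) (add_le_add_left hmq (Pi.single j s)) T hTs
  have hjD : j ∈ D := hjD j hjT (by simp [hjq])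
  have : maxUtility w (q + Pi.single j t) ≤ maxUtility w q - s := maxUtility_le fun U => by
    rw [utility_add_single]
    split_ifs with hU
    · linarith [utility_le_maxUtility w q U]
    · have h := mem_demand.1 hD U
      rw [utility_add_single, utility_add_single, if_neg hU, if_pos hjD] at h
      linarith [utility_le_maxUtility w q D]
  linarith

/-- The increase `a` is applied one coordinate at a time; raising other coordinates equally at `m`
and `q` preserves their agreement at the next one. -/
theorem GrossSubstitute.maxUtility_add_le [Fintype I] {w : Finset I → ℝ}
    (hw : GrossSubstitute w) {m q a : I → ℝ} (hm : 0 ≤ m) (hmq : m ≤ q) (ha : 0 ≤ a)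
    (h : ∀ j, a j = 0 ∨ m j = q j) :
    maxUtility w (q + a) + maxUtility w m ≤ maxUtility w (m + a) + maxUtility w q := by
  classical
  have key : ∀ K : Finset I,
      maxUtility w (q + ∑ j ∈ K, Pi.single j (a j)) + maxUtility w m ≤
        maxUtility w (m + ∑ j ∈ K, Pi.single j (a j)) + maxUtility w q := by
    intro K
    induction K using Finset.induction_on with
    | empty => simp [add_comm]
    | insert i K hi ih =>
      have hsum : (0 : I → ℝ) ≤ ∑ j ∈ K, Pi.single j (a j) :=
        Finset.sum_nonneg fun j _ => Pi.single_nonneg.2 (ha j)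
      have := hw.maxUtility_add_single_le (add_nonneg hm hsum) (add_le_add_left hmq _) (ha i)
        ((h i).imp_right fun e => by rw [Pi.add_apply, Pi.add_apply, e])
      rw [Finset.sum_insert hi, add_comm (Pi.single i (a i) : I → ℝ), ← add_assoc, ← add_assoc]
      linarith
  simpa only [Finset.univ_sum_single] using key Finset.univ

/-- The indirect utility of a gross-substitute valuation is submodular. -/
theorem GrossSubstitute.maxUtility_inf_add_maxUtility_sup_le [Fintype I] {w : Finset I → ℝ}
    (hw : GrossSubstitute w) {p q : I → ℝ} (hp : 0 ≤ p) (hq : 0 ≤ q) :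
    maxUtility w (p ⊓ q) + maxUtility w (p ⊔ q) ≤ maxUtility w p + maxUtility w q := by
  -- The increase from `q` to `p ⊔ q` is also the one from `p ⊓ q` to `p`, and it is nonzero only
  -- where `p ⊓ q` equals `q`.
  have h := hw.maxUtility_add_le (m := p ⊓ q) (q := q) (a := p ⊔ q - q) (le_inf hp hq)
    inf_le_right (sub_nonneg.2 le_sup_right) fun j => by
      rcases le_total (p j) (q j) with h | h <;> simp [h]
  have h1 : p ⊓ q + (p ⊔ q - q) = p := by
    rw [← add_sub_assoc, inf_add_sup, add_sub_cancel_right]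
  rw [h1, add_sub_cancel] at h
  linarith

/-! ### Walrasian equilibria with reserve prices -/

theorem IsAllocation.sum_sum [Fintype B] [DecidableEq I] {S : Finset I} {A : B → Finset I}
    (hA : IsAllocation S A) (f : I → ℝ) :
    ∑ b, ∑ j ∈ A b, f j = ∑ j ∈ Finset.univ.biUnion A, f j :=
  (Finset.sum_biUnion fun b _ c _ h => hA.2 b c h).symm

theorem IsAllocation.sum_sum_le [Fintype I] [Fintype B] {S : Finset I} {A : B → Finset I} (hA : IsAllocation S A)
    {f : I → ℝ} (hf : 0 ≤ f) : ∑ b, ∑ j ∈ A b, f j ≤ ∑ j, f j := by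
  classical
  rw [hA.sum_sum]
  exact Finset.sum_le_sum_of_subset_of_nonneg (Finset.subset_univ _) fun j _ _ => hf j

theorem IsAllocation.sum_sum_eq [Fintype I] [Fintype B] {S : Finset I} {A : B → Finset I} (hA : IsAllocation S A)
    {f : I → ℝ} (hf : ∀ j, (∀ b, j ∉ A b) → f j = 0) : ∑ b, ∑ j ∈ A b, f j = ∑ j, f j := by
  classical
  rw [hA.sum_sum]
  exact Finset.sum_subset (Finset.subset_univ _) fun j _ h => hf j (by simpa using h)

theorem IsAllocation.mono {S T : Finset I} {A : B → Finset I} (hA : IsAllocation S A)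
    (h : S ⊆ T) : IsAllocation T A :=
  ⟨fun b => (hA.1 b).trans h, hA.2⟩

/-- A Walrasian equilibrium with reserve prices `r`: the allocation is envy free, and the items that
are not allocated are offered at their reserve prices. -/
structure IsWalrasian [Fintype I] (v : B → Finset I → ℝ) (r p : I → ℝ) (A : B → Finset I) : Prop where
  reserve_le : r ≤ p
  envyFree : EnvyFree v Finset.univ p A
  eq_reserve : ∀ j, (∀ b, j ∉ A b) → p j = r j

theorem sum_utility [Fintype B] (v : B → Finset I → ℝ) (p : I → ℝ) (A : B → Finset I) :
    ∑ b, utility (v b) p (A b) = ∑ b, v b (A b) - ∑ b, ∑ j ∈ A b, p j := by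
  simp only [utility, Finset.sum_sub_distrib]

theorem EnvyFree.sum_maxUtility [Fintype I] [Fintype B] {v : B → Finset I → ℝ} {p : I → ℝ} {A : B → Finset I}
    (h : EnvyFree v Finset.univ p A) :
    ∑ b, maxUtility (v b) p = ∑ b, v b (A b) - ∑ b, ∑ j ∈ A b, p j := by
  rw [← sum_utility]
  exact Finset.sum_congr rfl fun b _ => (mem_demand_iff_eq_maxUtility.1 (h.2 b)).symm

theorem envyFree_of_sum_maxUtility_le [Fintype I] [Fintype B] {v : B → Finset I → ℝ} {p : I → ℝ} {A : B → Finset I}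
    (hA : IsAllocation Finset.univ A)
    (h : ∑ b, maxUtility (v b) p ≤ ∑ b, utility (v b) p (A b)) : EnvyFree v Finset.univ p A := by
  have hle : ∀ b ∈ Finset.univ, utility (v b) p (A b) ≤ maxUtility (v b) p :=
    fun b _ => utility_le_maxUtility _ _ _
  have h2 := (Finset.sum_eq_sum_iff_of_le hle).1 (le_antisymm (Finset.sum_le_sum hle) h)
  exact ⟨hA, fun b => mem_demand_iff_eq_maxUtility.2 (h2 b (Finset.mem_univ b))⟩

/-- The meet of Walrasian prices and envy-free prices is Walrasian, with the same allocation. -/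
theorem IsWalrasian.inf [Fintype I] [Fintype B] {v : B → Finset I → ℝ} (hgs : ∀ b, GrossSubstitute (v b))
    {r p q : I → ℝ} {A : B → Finset I} (hr : 0 ≤ r) (h : IsWalrasian v r p A) (hrq : r ≤ q)
    (hq : EnvyFreePrices v Finset.univ q) : IsWalrasian v r (p ⊓ q) A := by
  obtain ⟨C, hC⟩ := hq
  have hreserve : ∀ j, (∀ b, j ∉ A b) → (p ⊓ q) j = r j := fun j hj => by
    rw [Pi.inf_apply, h.eq_reserve j hj]
    exact inf_eq_left.2 (hrq j)
  refine ⟨le_inf h.reserve_le hrq, envyFree_of_sum_maxUtility_le h.envyFree.1 ?_, hreserve⟩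
  -- Total indirect utility plus the sum of all prices is submodular. `C` can pay for at most the
  -- whole increase from `q` to `p ⊔ q`, while `A` bears the whole increase from `p ⊓ q` to `p`;
  -- these two increases have the same total.
  have h1 : ∑ b, maxUtility (v b) (p ⊓ q) + ∑ b, maxUtility (v b) (p ⊔ q) ≤
      ∑ b, maxUtility (v b) p + ∑ b, maxUtility (v b) q := by
    rw [← Finset.sum_add_distrib, ← Finset.sum_add_distrib]
    exact Finset.sum_le_sum fun b _ =>
      (hgs b).maxUtility_inf_add_maxUtility_sup_le (hr.trans h.reserve_le) (hr.trans hrq)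
  have h2 : ∑ b, utility (v b) (p ⊔ q) (C b) ≤ ∑ b, maxUtility (v b) (p ⊔ q) :=
    Finset.sum_le_sum fun b _ => utility_le_maxUtility _ _ _
  have h3 := hC.1.sum_sum_le (f := p ⊔ q - q) (sub_nonneg.2 le_sup_right)
  have h4 := h.envyFree.1.sum_sum_eq (f := p - p ⊓ q) fun j hj => by
    rw [Pi.sub_apply, hreserve j hj, h.eq_reserve j hj, sub_self]
  have h5 : ∑ j, (p ⊓ q) j + ∑ j, (p ⊔ q) j = ∑ j, p j + ∑ j, q j := by
    rw [← Finset.sum_add_distrib, ← Finset.sum_add_distrib]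
    exact Finset.sum_congr rfl fun j _ => congrFun (inf_add_sup p q) j
  simp only [Pi.sub_apply, Finset.sum_sub_distrib] at h3 h4
  rw [h.envyFree.sum_maxUtility, hC.sum_maxUtility] at h1
  rw [sum_utility] at h2 ⊢
  linarith

/-! ### The ascending auction -/

/-- The prices that a bidder holding the items of `T` faces in the ascending auction with
reserve prices `r` and increment `ε`, after `k j` increments of the price of `j`. -/
noncomputable def auctionPrice [DecidableEq I] (r : I → ℝ) (ε : ℝ) (k : I → ℕ) (T : Finset I)
    (j : I) : ℝ :=
  r j + ε * (k j + if j ∈ T then 0 else 1)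

/-- The states of the ascending auction. -/
structure IsAuctionState [Fintype I] [DecidableEq I] (v : B → Finset I → ℝ) (r : I → ℝ)
    (ε V : ℝ) (k : I → ℕ) (A : B → Finset I) : Prop where
  isAllocation : IsAllocation Finset.univ A
  exists_mem : ∀ j, k j ≠ 0 → ∃ b, j ∈ A b
  le_bound : ∀ j, k j ≠ 0 → r j + ε * k j ≤ V
  exists_demand : ∀ b, ∃ D ∈ demand (v b) (auctionPrice r ε k (A b)), A b ⊆ D

/-- Bidder `b` takes a demanded superset `D` of its holding, and each newly taken item rises by one
increment. The other bidders keep what is left at unchanged prices while all other prices weakly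
rise, so by gross substitutability their holdings still extend to demanded sets. -/
theorem IsAuctionState.exists_lt [Fintype I] [DecidableEq I] {v : B → Finset I → ℝ}
    (hgs : ∀ b, GrossSubstitute (v b)) {r : I → ℝ} (hr : 0 ≤ r) {ε V : ℝ} (hε : 0 < ε)
    (hV : ∀ b T U, v b T - v b U ≤ V) {k : I → ℕ} {A : B → Finset I}
    (h : IsAuctionState v r ε V k A) {b : B}
    (hb : A b ∉ demand (v b) (auctionPrice r ε k (A b))) :
    ∃ k' A', k < k' ∧ IsAuctionState v r ε V k' A' := by
  classical
  obtain ⟨D, hD, hAD⟩ := h.exists_demand b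
  let k' : I → ℕ := fun j => k j + if j ∈ D \ A b then 1 else 0
  let A' : B → Finset I := fun c => if c = b then D else A c \ D
  have hkk' : k ≤ k' := fun j => Nat.le_add_right _ _
  -- Items not held are already quoted one increment higher, so taking them does not change the
  -- prices that `b` faces.
  have hprice : auctionPrice r ε k' D = auctionPrice r ε k (A b) := by
    ext j
    by_cases hj : j ∈ D <;> by_cases hj' : j ∈ A b
    · simp [auctionPrice, k', hj, hj']
    · simp [auctionPrice, k', hj, hj']
    · exact absurd (hAD hj') hj
    · simp [auctionPrice, k', hj, hj']
  refine ⟨k', A', lt_of_le_of_ne hkk' fun he => hb ?_, ⟨fun c => Finset.subset_univ _, ?_⟩,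
    fun j hj => ?_, fun j hj => ?_, fun c => ?_⟩
  · have : A b = D := hAD.antisymm fun j hj => by
      by_contra hj'
      have := congrFun he j
      simp [k', hj, hj'] at this
    rwa [this] at hD ⊢
  · intro c d hcd
    by_cases hc : c = b <;> by_cases hd : d = b
    · exact absurd (hc.trans hd.symm) hcd
    · simpa [A', hc, hd] using Finset.disjoint_sdiff
    · simpa [A', hc, hd] using Finset.sdiff_disjoint
    · simpa [A', hc, hd] using
        (h.isAllocation.2 c d hcd).mono Finset.sdiff_subset Finset.sdiff_subset
  · by_cases hjD : j ∈ D
    · exact ⟨b, by simpa [A'] using hjD⟩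
    · obtain ⟨c, hc⟩ := h.exists_mem j (by simpa [k', hjD] using hj)
      have hcb : c ≠ b := fun e => hjD (hAD (e ▸ hc))
      exact ⟨c, by simp [A', hcb, hc, hjD]⟩
  · by_cases hjD : j ∈ D \ A b
    -- An item in a demanded set costs at most its marginal value, hence at most `V`.
    · obtain ⟨hj1, hj2⟩ := Finset.mem_sdiff.1 hjD
      have h1 := mem_demand.1 hD (D.erase j)
      have h2 := Finset.add_sum_erase D (auctionPrice r ε k (A b)) hj1
      have h3 := hV b D (D.erase j)
      have h4 : auctionPrice r ε k (A b) j = r j + ε * k' j := by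
        simp [auctionPrice, k', hj1, hj2]
      simp only [utility] at h1
      linarith
    · simp only [k', hjD, if_false, add_zero] at hj ⊢
      exact h.le_bound j hj
  · by_cases hc : c = b
    · subst hc
      exact ⟨D, by simpa [A', hprice] using hD, by simp [A']⟩
    · obtain ⟨E, hE, hAE⟩ := h.exists_demand c
      have hle : auctionPrice r ε k (A c) ≤ auctionPrice r ε k' (A c \ D) := fun j => by
        have h1 : (k j : ℝ) ≤ k' j := by exact_mod_cast hkk' j
        have h2 : (if j ∈ A c then (0 : ℝ) else 1) ≤ if j ∈ A c \ D then 0 else 1 := by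
          by_cases hj1 : j ∈ A c <;> by_cases hj2 : j ∈ D <;> simp [hj1, hj2]
        simp only [auctionPrice]
        gcongr
      have h0 : 0 ≤ auctionPrice r ε k (A c) := fun j => by
        have := hr j
        simp only [auctionPrice, Pi.zero_apply] at this ⊢
        split_ifs <;> positivity
      obtain ⟨E', hE', hsub⟩ := hgs c _ _ h0 hle E hE
      simp only [A', hc, if_false]
      refine ⟨E', hE', fun j hj => ?_⟩
      obtain ⟨hj1, hj2⟩ := Finset.mem_sdiff.1 hj
      exact hsub j (hAE hj1) (by simp [auctionPrice, k', hj1, hj2])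

/-- The ascending auction ends in an approximate Walrasian equilibrium. -/
theorem exists_approx_isWalrasian [Fintype I] {v : B → Finset I → ℝ}
    (hgs : ∀ b, GrossSubstitute (v b))
    {r : I → ℝ} (hr : 0 ≤ r) {V : ℝ} (hV : ∀ b T U, v b T - v b U ≤ V) {ε : ℝ} (hε : 0 < ε) :
    ∃ (p : I → ℝ) (A : B → Finset I), r ≤ p ∧ (∀ j, p j ≤ max (r j) V) ∧
      IsAllocation Finset.univ A ∧ (∀ j, (∀ b, j ∉ A b) → p j = r j) ∧
      ∀ b U, utility (v b) p U ≤ utility (v b) p (A b) + ε * Fintype.card I := by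
  classical
  let s : Set (I → ℕ) := {k | ∃ A : B → Finset I, IsAuctionState v r ε V k A}
  have hfin : s.Finite := by
    refine (Set.finite_Iic fun _ => ⌈V / ε⌉₊).subset ?_
    rintro k ⟨A, hA⟩ j
    by_cases hj : k j = 0
    · simp [hj]
    · have h1 := hA.le_bound j hj
      have h2 : 0 ≤ r j := hr j
      have h3 : (k j : ℝ) ≤ V / ε := by
        rw [le_div_iff₀ hε]
        linarith
      exact_mod_cast h3.trans (Nat.le_ceil _)
  have hne : s.Nonempty := by
    refine ⟨0, fun _ => ∅, ⟨fun _ => Finset.empty_subset _, fun _ _ _ =>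
      Finset.disjoint_empty_left _⟩, fun j hj => absurd rfl hj, fun j hj => absurd rfl hj,
      fun b => ?_⟩
    obtain ⟨D, hD⟩ := exists_utility_eq_maxUtility (v b) (auctionPrice r ε 0 ∅)
    exact ⟨D, mem_demand_iff_eq_maxUtility.2 hD, Finset.empty_subset _⟩
  -- At a maximal state no bidder can move, so every holding is demanded at that bidder's prices,
  -- which exceed the posted ones by at most `ε` per item.
  obtain ⟨k, ⟨A, hA⟩, hmax⟩ := hfin.exists_maximal hne
  have hdemand : ∀ b, A b ∈ demand (v b) (auctionPrice r ε k (A b)) := by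
    intro b
    by_contra hb
    obtain ⟨k', A', hlt, hA'⟩ := hA.exists_lt hgs hr hε hV hb
    exact hlt.not_ge (hmax ⟨A', hA'⟩ hlt.le)
  refine ⟨fun j => r j + ε * k j, A, fun j => ?_, fun j => ?_, hA.isAllocation, fun j hj => ?_,
    fun b U => ?_⟩
  · have : 0 ≤ ε * k j := by positivity
    linarith
  · by_cases hj : k j = 0
    · simp [hj]
    · exact le_max_of_le_right (hA.le_bound j hj)
  · have : k j = 0 := by
      by_contra h
      obtain ⟨b, hb⟩ := hA.exists_mem j h
      exact hj b hb
    simp [this]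
  · have h1 := mem_demand.1 (hdemand b) U
    have h2 : ∑ j ∈ A b, auctionPrice r ε k (A b) j = ∑ j ∈ A b, (r j + ε * k j) :=
      Finset.sum_congr rfl fun j hj => by simp [auctionPrice, hj]
    have h3 : ∑ j ∈ U, auctionPrice r ε k (A b) j ≤
        ∑ j ∈ U, (r j + ε * k j) + ε * Fintype.card I := by
      calc ∑ j ∈ U, auctionPrice r ε k (A b) j ≤ ∑ j ∈ U, ((r j + ε * k j) + ε) :=
            Finset.sum_le_sum fun j _ => by
              simp only [auctionPrice]
              split_ifs <;> linarith
        _ ≤ _ := by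
            rw [Finset.sum_add_distrib, Finset.sum_const, nsmul_eq_mul, mul_comm ε]
            gcongr
            exact Finset.card_le_univ U
    simp only [utility] at h1 ⊢
    linarith

theorem exists_valuation_bound [Fintype I] [Fintype B] (v : B → Finset I → ℝ) :
    ∃ V : ℝ, ∀ b T U, v b T - v b U ≤ V := by
  obtain ⟨V, hV⟩ := (Set.finite_range fun x : B × Finset I × Finset I =>
    v x.1 x.2.1 - v x.1 x.2.2).bddAbove
  exact ⟨V, fun b T U => hV ⟨(b, T, U), rfl⟩⟩

/-- Walrasian equilibria exist for gross-substitute valuations. -/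
theorem exists_isWalrasian [Fintype I] [Fintype B] {v : B → Finset I → ℝ}
    (hgs : ∀ b, GrossSubstitute (v b)) {r : I → ℝ} (hr : 0 ≤ r) :
    ∃ (p : I → ℝ) (A : B → Finset I), IsWalrasian v r p A := by
  obtain ⟨V, hV⟩ := exists_valuation_bound v
  have hε : ∀ n : ℕ, (0 : ℝ) < 1 / (n + 1) := fun n => Nat.one_div_pos_of_nat
  choose p A hrp hpV hA hreserve hutility using
    fun n : ℕ => exists_approx_isWalrasian hgs hr hV (hε n)
  obtain ⟨p₀, -, φ, hφ, hlim⟩ := (isCompact_Icc (a := r) (b := fun j => max (r j) V)).tendsto_subseq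
    fun n => ⟨hrp n, hpV n⟩
  -- There are finitely many allocations, so one recurs infinitely often along the convergent
  -- subsequence of prices.
  obtain ⟨A₀, hA₀⟩ := Finite.exists_infinite_fiber (A ∘ φ)
  have hfreq : ∃ᶠ n in Filter.atTop, A (φ n) = A₀ :=
    Nat.frequently_atTop_iff_infinite.2 (Set.infinite_coe_iff.1 hA₀)
  have hlimj : ∀ j, Filter.Tendsto (fun n => p (φ n) j) Filter.atTop (nhds (p₀ j)) :=
    tendsto_pi_nhds.1 hlim
  obtain ⟨n₀, hn₀⟩ := hfreq.exists
  refine ⟨p₀, A₀, fun j => ge_of_tendsto' (hlimj j) fun n => hrp (φ n) j,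
    ⟨hn₀ ▸ hA (φ n₀), fun b => mem_demand.2 fun U => ?_⟩, fun j hj => ?_⟩
  · have hu : ∀ T, Filter.Tendsto (fun n => utility (v b) (p (φ n)) T) Filter.atTop
        (nhds (utility (v b) p₀ T)) := fun T =>
      tendsto_const_nhds.sub (tendsto_finsetSum T fun j _ => hlimj j)
    have he : Filter.Tendsto (fun n => 1 / ((φ n : ℝ) + 1) * Fintype.card I) Filter.atTop
        (nhds 0) := by
      simpa using ((tendsto_one_div_add_atTop_nhds_zero_nat (𝕜 := ℝ)).comp
        hφ.tendsto_atTop).mul_const (Fintype.card I : ℝ)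
    refine le_of_tendsto_of_tendsto_of_frequently (hu U)
      (by simpa using (hu (A₀ b)).add he) (hfreq.mono fun n hn => ?_)
    simpa [hn] using hutility (φ n) b U
  · refine tendsto_nhds_unique_of_frequently_eq (hlimj j) tendsto_const_nhds
      (hfreq.mono fun n hn => hreserve (φ n) j (by simpa [hn] using hj))

/-! ### Minimal envy-free prices -/

/-- Minimal envy-free prices are Walrasian. -/
theorem exists_isWalrasian_of_minimal [Fintype I] [Fintype B] {v : B → Finset I → ℝ}
    (hgs : ∀ b, GrossSubstitute (v b))
    {r p : I → ℝ} (hr : 0 ≤ r)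
    (hp : Minimal (fun q => r ≤ q ∧ EnvyFreePrices v Finset.univ q) p) :
    ∃ A, IsWalrasian v r p A := by
  obtain ⟨q, A, hA⟩ := exists_isWalrasian hgs hr
  have h := hA.inf hgs hr hp.prop.1 hp.prop.2
  have : q ⊓ p = p := hp.eq_of_le ⟨h.reserve_le, A, h.envyFree⟩ inf_le_right
  exact ⟨A, this ▸ h⟩

/-- Minimal envy-free prices are least. -/
theorem le_of_minimal [Fintype I] [Fintype B] {v : B → Finset I → ℝ}
    (hgs : ∀ b, GrossSubstitute (v b))
    {r p q : I → ℝ} (hr : 0 ≤ r)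
    (hp : Minimal (fun q => r ≤ q ∧ EnvyFreePrices v Finset.univ q) p) (hq : r ≤ q)
    (hqe : EnvyFreePrices v Finset.univ q) : p ≤ q := by
  obtain ⟨A, hA⟩ := exists_isWalrasian_of_minimal hgs hr hp
  have h := hA.inf hgs hr hq hqe
  exact inf_eq_left.1 (hp.eq_of_le ⟨h.reserve_le, A, h.envyFree⟩ inf_le_left)

/-! ### Auctions of some of the items -/

theorem utility_piecewise_of_subset [DecidableEq I] (w : Finset I → ℝ) {S T : Finset I}
    (p H : I → ℝ) (h : T ⊆ S) : utility w (S.piecewise p H) T = utility w p T := by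
  simp only [utility]
  rw [Finset.sum_congr rfl fun j hj => S.piecewise_eq_of_mem p H (h hj)]

/-- Dropping all items outside `S` loses value at most `V` but saves the price of at least one of
them, which exceeds `V`. -/
theorem utility_piecewise_lt [DecidableEq I] {w : Finset I → ℝ} {V : ℝ}
    (hV : ∀ T U, w T - w U ≤ V) {S U : Finset I} {p H : I → ℝ} (hH : ∀ j, V < H j)
    (hU : ¬ U ⊆ S) : utility w (S.piecewise p H) U < utility w p (U ∩ S) := by
  obtain ⟨j, hj, hjS⟩ := Finset.not_subset.1 hU
  have hV0 : 0 ≤ V := by simpa using hV U U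
  have h1 : H j ≤ ∑ i ∈ U \ S, H i :=
    Finset.single_le_sum (fun i _ => (hV0.trans_lt (hH i)).le) (Finset.mem_sdiff.2 ⟨hj, hjS⟩)
  have h2 : ∑ i ∈ U, S.piecewise p H i = ∑ i ∈ U ∩ S, p i + ∑ i ∈ U \ S, H i :=
    Finset.sum_piecewise U S p H
  simp only [utility, h2]
  linarith [hH j, hV U (U ∩ S)]

/-- Withholding items amounts to prohibitive prices for them. -/
theorem demand_piecewise [Fintype I] [DecidableEq I] {w : Finset I → ℝ} {V : ℝ}
    (hV : ∀ T U, w T - w U ≤ V) {S : Finset I} {p H : I → ℝ} (hH : ∀ j, V < H j) :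
    demand w (S.piecewise p H) = demandOn w S p := by
  ext T
  rw [mem_demand]
  constructor
  · intro h
    have hTS : T ⊆ S := by
      by_contra hTS
      have h1 := utility_piecewise_lt hV (p := p) hH hTS
      have h2 := h (T ∩ S)
      rw [utility_piecewise_of_subset w p H Finset.inter_subset_right] at h2
      linarith
    refine ⟨hTS, fun U hU => ?_⟩
    simpa only [utility_piecewise_of_subset w p H hU, utility_piecewise_of_subset w p H hTS]
      using h U
  · rintro ⟨hTS, h⟩ U
    rw [utility_piecewise_of_subset w p H hTS]
    by_cases hU : U ⊆ S
    · rw [utility_piecewise_of_subset w p H hU]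
      exact h U hU
    · exact (utility_piecewise_lt hV hH hU).le.trans (h _ Finset.inter_subset_right)

theorem exists_prohibitive_prices (r : I → ℝ) (V : ℝ) :
    ∃ H : I → ℝ, r ≤ H ∧ ∀ j, V < H j :=
  ⟨fun j => max (r j) (V + 1), fun _ => le_max_left _ _, fun _ =>
    (lt_add_one V).trans_le (le_max_right _ _)⟩

theorem envyFree_piecewise [Fintype I] [DecidableEq I] {v : B → Finset I → ℝ} {V : ℝ}
    (hV : ∀ b T U, v b T - v b U ≤ V) {S : Finset I} {p H : I → ℝ} (hH : ∀ j, V < H j)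
    {A : B → Finset I} : EnvyFree v Finset.univ (S.piecewise p H) A ↔ EnvyFree v S p A := by
  have h : ∀ b, demandOn (v b) Finset.univ (S.piecewise p H) = demandOn (v b) S p :=
    fun b => demand_piecewise (hV b) hH
  simp only [EnvyFree, h]
  exact ⟨fun hA => ⟨⟨fun b => (hA.2 b).1, hA.1.2⟩, hA.2⟩,
    fun hA => ⟨hA.1.mono (Finset.subset_univ S), hA.2⟩⟩

theorem envyFreePrices_piecewise [Fintype I] [DecidableEq I] {v : B → Finset I → ℝ} {V : ℝ}
    (hV : ∀ b T U, v b T - v b U ≤ V) {S : Finset I} {p H : I → ℝ} (hH : ∀ j, V < H j) :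
    EnvyFreePrices v Finset.univ (S.piecewise p H) ↔ EnvyFreePrices v S p :=
  exists_congr fun _ => envyFree_piecewise hV hH

theorem EnvyFree.of_univ [Fintype I] {v : B → Finset I → ℝ} {S : Finset I} {p : I → ℝ}
    {A : B → Finset I} (h : EnvyFree v Finset.univ p A) (hA : ∀ b, A b ⊆ S) : EnvyFree v S p A :=
  ⟨⟨hA, h.1.2⟩, fun b => ⟨hA b, fun U _ => (h.2 b).2 U (Finset.subset_univ U)⟩⟩

/-- If one envy-free allocation on `S` is envy free on all items, then all of them are. -/
theorem EnvyFree.to_univ [Fintype I] {v : B → Finset I → ℝ} {S : Finset I} {p : I → ℝ}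
    {A A' : B → Finset I} (h : EnvyFree v Finset.univ p A) (hA : ∀ b, A b ⊆ S)
    (h' : EnvyFree v S p A') : EnvyFree v Finset.univ p A' :=
  ⟨h'.1.mono (Finset.subset_univ S), fun b => mem_demand.2 fun U =>
    (mem_demand.1 (h.2 b) U).trans ((h'.2 b).2 _ (hA b))⟩

/-- At minimal prices of the virtual auction on `S` there is an envy-free allocation of all items
of `S` that are more expensive than their reserve prices. -/
theorem exists_envyFree_of_minimal [Fintype I] [Fintype B] {v : B → Finset I → ℝ}
    (hgs : ∀ b, GrossSubstitute (v b)) {r p : I → ℝ} (hr : 0 ≤ r) {S : Finset I}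
    (hp : Minimal (IsReserveEnvyFreePrice v r S) p) :
    ∃ A, EnvyFree v S p A ∧ ∀ j, (∀ b, j ∉ A b) → p j = r j := by
  classical
  obtain ⟨V, hV⟩ := exists_valuation_bound v
  obtain ⟨H, hrH, hH⟩ := exists_prohibitive_prices r V
  -- Prohibitive reserves outside `S` turn the auction on `S` into one on all items; any competitor
  -- below is pinned to `H` there, so it comes from a candidate on `S`.
  have hmin : Minimal (fun q => S.piecewise r H ≤ q ∧ EnvyFreePrices v Finset.univ q)
      (S.piecewise p H) := by
    refine ⟨⟨Finset.piecewise_le_piecewise S hp.prop.1 le_rfl,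
      (envyFreePrices_piecewise hV hH).2 hp.prop.2.2⟩, ?_⟩
    rintro q ⟨hq, hqe⟩ hqp
    have hqH : ∀ j, j ∉ S → q j = H j := fun j hj => by
      have h1 := hq j
      have h2 := hqp j
      rw [Finset.piecewise_eq_of_notMem _ _ _ hj] at h1 h2
      exact le_antisymm h2 h1
    have hqq : S.piecewise (S.piecewise q r) H = q := by
      ext j
      by_cases hj : j ∈ S <;> simp [hj, hqH]
    have hle : S.piecewise q r ≤ p := fun j => by
      by_cases hj : j ∈ S
      · simpa [hj] using hqp j
      · simpa [hj] using hp.prop.1 j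
    have hqr : IsReserveEnvyFreePrice v r S (S.piecewise q r) := by
      refine ⟨fun j => ?_, fun j hj => by simp [hj], ?_⟩
      · by_cases hj : j ∈ S
        · simpa [hj] using hq j
        · simp [hj]
      · rwa [← envyFreePrices_piecewise hV hH, hqq]
    have := hp.eq_of_le hqr hle
    rw [← this, hqq]
  have hr' : 0 ≤ S.piecewise r H := fun j => by
    by_cases hj : j ∈ S
    · simpa [hj] using hr j
    · simpa [hj] using (hr j).trans (hrH j)
  obtain ⟨A, hA⟩ := exists_isWalrasian_of_minimal hgs hr' hmin
  refine ⟨A, (envyFree_piecewise hV hH).1 hA.envyFree, fun j hj => ?_⟩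
  by_cases hjS : j ∈ S
  · simpa [hjS] using hA.eq_reserve j hj
  · exact hp.prop.2.1 j hjS

theorem minimal_of_minimal_univ [Fintype I] {v : B → Finset I → ℝ} {r p : I → ℝ}
    (hp : Minimal (IsReserveEnvyFreePrice v r Finset.univ) p) :
    Minimal (fun q => r ≤ q ∧ EnvyFreePrices v Finset.univ q) p := by
  have h : IsReserveEnvyFreePrice v r Finset.univ =
      fun q => r ≤ q ∧ EnvyFreePrices v Finset.univ q := by
    ext q
    simp [IsReserveEnvyFreePrice]
  rwa [h] at hp

/-- If the least envy-free prices for all items support an allocation of items of `S`, then they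
are also the minimal prices of the virtual auction on `S`. -/
theorem eq_of_minimal_of_isWalrasian [Fintype I] [Fintype B] {v : B → Finset I → ℝ}
    (hgs : ∀ b, GrossSubstitute (v b)) {r p q : I → ℝ} (hr : 0 ≤ r) {S : Finset I}
    {A : B → Finset I} (hq : Minimal (fun q => r ≤ q ∧ EnvyFreePrices v Finset.univ q) q)
    (hA : IsWalrasian v r q A) (hAS : ∀ b, A b ⊆ S)
    (hp : Minimal (IsReserveEnvyFreePrice v r S) p) : p = q := by
  classical
  obtain ⟨V, hV⟩ := exists_valuation_bound v
  obtain ⟨H, hrH, hH⟩ := exists_prohibitive_prices r V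
  have hqS : ∀ j, j ∉ S → q j = r j := fun j hj => hA.eq_reserve j fun b hb => hj (hAS b hb)
  -- Raising `p` to `H` outside `S` gives envy-free prices for all items, to which leastness of `q`
  -- applies.
  have h1 : q ≤ S.piecewise p H := by
    refine le_of_minimal hgs hr hq (fun j => ?_) ((envyFreePrices_piecewise hV hH).2 hp.prop.2.2)
    by_cases hj : j ∈ S
    · simpa [hj] using hp.prop.1 j
    · simpa [hj] using hrH j
  have h2 : q ≤ p := fun j => by
    by_cases hj : j ∈ S
    · simpa [hj] using h1 j
    · rw [hqS j hj]
      exact hp.prop.1 j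
  exact (hp.eq_of_le ⟨hA.reserve_le, hqS, A, hA.envyFree.of_univ hAS⟩ h2).symm

/-! ### Welfare -/

/-- The first welfare theorem. -/
theorem IsWalrasian.welfare_le [Fintype I] [Fintype B] {v : B → Finset I → ℝ} {r p : I → ℝ}
    {A A' : B → Finset I} (h : IsWalrasian v r p A) (hA' : IsAllocation Finset.univ A') :
    ∑ b, v b (A' b) - ∑ b, ∑ j ∈ A' b, r j ≤ ∑ b, v b (A b) - ∑ b, ∑ j ∈ A b, r j := by
  have h1 : ∑ b, utility (v b) p (A' b) ≤ ∑ b, utility (v b) p (A b) :=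
    Finset.sum_le_sum fun b _ => mem_demand.1 (h.envyFree.2 b) _
  have h2 := hA'.sum_sum_le (f := p - r) (sub_nonneg.2 h.reserve_le)
  have h3 := h.envyFree.1.sum_sum_eq (f := p - r) fun j hj => by simp [h.eq_reserve j hj]
  simp only [Pi.sub_apply, Finset.sum_sub_distrib] at h2 h3
  rw [sum_utility, sum_utility] at h1
  linarith

/-- The second welfare theorem: Walrasian prices support every optimal allocation. -/
theorem IsWalrasian.of_welfare_le [Fintype I] [Fintype B] {v : B → Finset I → ℝ} {r p : I → ℝ}
    {A A' : B → Finset I} (h : IsWalrasian v r p A) (hA' : IsAllocation Finset.univ A')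
    (hle : ∑ b, v b (A b) - ∑ b, ∑ j ∈ A b, r j ≤ ∑ b, v b (A' b) - ∑ b, ∑ j ∈ A' b, r j) :
    IsWalrasian v r p A' := by
  classical
  have h1 : ∑ b, utility (v b) p (A' b) ≤ ∑ b, utility (v b) p (A b) :=
    Finset.sum_le_sum fun b _ => mem_demand.1 (h.envyFree.2 b) _
  have hpr : 0 ≤ p - r := sub_nonneg.2 h.reserve_le
  have h2 := hA'.sum_sum_le hpr
  have h3 := h.envyFree.1.sum_sum_eq (f := p - r) fun j hj => by simp [h.eq_reserve j hj]
  have h4 := h.envyFree.sum_maxUtility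
  have h5 := hA'.sum_sum (p - r)
  simp only [Pi.sub_apply, Finset.sum_sub_distrib] at h2 h3 h5
  rw [sum_utility, sum_utility] at h1
  refine ⟨h.reserve_le, envyFree_of_sum_maxUtility_le hA' ?_, fun j hj => ?_⟩
  · rw [sum_utility]
    linarith
  -- Optimality forces `A'` to collect the entire markup `p - r`; an unallocated item therefore has
  -- none.
  · have h6 : j ∉ Finset.univ.biUnion A' := by simpa using hj
    have h7 := Finset.sum_le_sum_of_subset_of_nonneg (f := p - r)
      (Finset.subset_univ (insert j (Finset.univ.biUnion A'))) fun i _ _ => hpr i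
    rw [Finset.sum_insert h6] at h7
    simp only [Pi.sub_apply, Finset.sum_sub_distrib] at h7
    have h8 : r j ≤ p j := h.reserve_le j
    linarith

theorem sum_le_orValuation [Fintype I] [Fintype B] {v : B → Finset I → ℝ} {S : Finset I}
    {A : B → Finset I} (hA : IsAllocation S A) : ∑ b, v b (A b) ≤ orValuation v S :=
  (isGreatest_orValuation v S).2 ⟨A, hA, rfl⟩

theorem exists_isOptimalORAllocation [Fintype I] [Fintype B] (v : B → Finset I → ℝ)
    (S : Finset I) : ∃ A, IsOptimalORAllocation v S A := by
  obtain ⟨A, hA, h⟩ := (isGreatest_orValuation v S).1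
  exact ⟨A, hA, h.symm⟩

theorem isAllocation_biUnion [Fintype B] [DecidableEq I] {S : Finset I} {A : B → Finset I}
    (hA : IsAllocation S A) : IsAllocation (Finset.univ.biUnion A) A :=
  ⟨fun b => Finset.subset_biUnion_of_mem A (Finset.mem_univ b), hA.2⟩

/-- Minimal prices support the optimal allocations of the sets that the OR-player demands. -/
theorem IsWalrasian.of_mem_demand_orValuation [Fintype I] [Fintype B] {v : B → Finset I → ℝ}
    {r p : I → ℝ} {A A' : B → Finset I} {S : Finset I} (hr : 0 ≤ r) (h : IsWalrasian v r p A)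
    (hS : S ∈ demand (orValuation v) r) (hA' : IsOptimalORAllocation v S A') :
    IsWalrasian v r p A' := by
  classical
  refine h.of_welfare_le (hA'.1.mono (Finset.subset_univ S)) ?_
  have h1 := mem_demand.1 hS (Finset.univ.biUnion A)
  have h2 := sum_le_orValuation (v := v) (isAllocation_biUnion h.envyFree.1)
  have h3 : ∑ j ∈ Finset.univ.biUnion A', r j ≤ ∑ j ∈ S, r j :=
    Finset.sum_le_sum_of_subset_of_nonneg (Finset.biUnion_subset.2 fun b _ => hA'.1.1 b)
      fun j _ _ => hr j
  simp only [utility] at h1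
  rw [h.envyFree.1.sum_sum, hA'.1.sum_sum, hA'.2]
  linarith

/-- The items of a set that the OR-player demands are worth their prices, at all prices above the
reserve prices. -/
theorem sum_reserve_le_of_mem_demand_orValuation [Fintype I] [Fintype B]
    {v : B → Finset I → ℝ} {r p : I → ℝ} {A : B → Finset I} {S : Finset I} (hrp : r ≤ p)
    (hS : S ∈ demand (orValuation v) r) (hA : IsOptimalORAllocation v S A) :
    ∑ j ∈ S, r j ≤ ∑ b, ∑ j ∈ A b, p j := by
  classical
  -- The allocated items alone realize the OR-value of `S`, so by demand the unallocated ones have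
  -- total reserve price at most zero.
  have h1 := mem_demand.1 hS (Finset.univ.biUnion A)
  have h2 := sum_le_orValuation (v := v) (isAllocation_biUnion hA.1)
  have h3 : ∑ j ∈ Finset.univ.biUnion A, r j ≤ ∑ j ∈ Finset.univ.biUnion A, p j :=
    Finset.sum_le_sum fun j _ => hrp j
  simp only [utility] at h1
  rw [hA.1.sum_sum]
  linarith [hA.2]

/-- The prices of the virtual auction are the least envy-free prices for all items whenever its
allocation is envy free on all items. -/
theorem eq_of_isVirtualAuctionOutcome [Fintype I] [Fintype B] {v : B → Finset I → ℝ}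
    (hgs : ∀ b, GrossSubstitute (v b)) {r p q : I → ℝ} (hr : 0 ≤ r) {S : Finset I}
    {A C : B → Finset I} (hq : Minimal (fun q => r ≤ q ∧ EnvyFreePrices v Finset.univ q) q)
    (hC : IsWalrasian v r q C) (hpA : IsVirtualAuctionOutcome v r S p A)
    (hA : EnvyFree v Finset.univ p A) : p = q := by
  obtain ⟨A', hA', hreserve⟩ := exists_envyFree_of_minimal hgs hr hpA.minimal_price
  have hW : IsWalrasian v r p A' :=
    ⟨hpA.minimal_price.prop.1, hA.to_univ hpA.envyFree.1.1 hA', hreserve⟩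
  -- `A'` and `C` are both welfare-optimal, so `q` supports `A'`, which uses only items of `S`.
  exact eq_of_minimal_of_isWalrasian hgs hr hq
    (hC.of_welfare_le hW.envyFree.1 (hW.welfare_le hC.envyFree.1)) hA'.1.1 hpA.minimal_price

end

end AdExchange

open AdExchange

theorem mainTheorem1 {I B : Type*} [Fintype I] [Fintype B] (v : B → Finset I → ℝ)
    (hv_empty : ∀ b, v b ∅ = 0) (hv_mono : ∀ b, Monotone (v b))
    (hv_gs : ∀ b, AdExchange.GrossSubstitute (v b))
    (M : AdExchange.EFMediator v) (r : I → ℝ) (hr : 0 ≤ r) :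
    M.demand r = AdExchange.demand (AdExchange.orValuation v) r ∧
    ∀ S ∈ M.demand r,
      AdExchange.IsOptimalORAllocation v S (M.alloc r S) ∧
      ∀ A : B → Finset I, AdExchange.IsOptimalORAllocation v S A →
        AdExchange.IsVirtualAuctionOutcome v r S (M.price r S) A ∧
        AdExchange.EnvyFree v Finset.univ (M.price r S) A ∧
        AdExchange.outcomeRevenue v r S (M.price r S) A = M.revenue r S := by
  -- The mediator's own auction of all items supplies the minimal prices.
  obtain ⟨q, hq⟩ : ∃ q, Minimal (fun q => r ≤ q ∧ EnvyFreePrices v Finset.univ q) q :=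
    ⟨_, minimal_of_minimal_univ (M.isOutcome r hr Finset.univ).minimal_price⟩
  obtain ⟨C, hC⟩ := exists_isWalrasian_of_minimal hv_gs hr hq
  obtain ⟨U, hU⟩ : ∃ U, U = ∑ b, maxUtility (v b) q := ⟨_, rfl⟩
  have hpay : ∀ A : B → Finset I, EnvyFree v Finset.univ q A →
      ∑ b, ∑ j ∈ A b, q j = ∑ b, v b (A b) - U := fun A hA => by
    rw [hU, hA.sum_maxUtility]
    ring
  have hprice : ∀ S ∈ demand (orValuation v) r, M.price r S = q := fun S hS => by
    obtain ⟨A, hA⟩ := exists_isOptimalORAllocation v S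
    exact eq_of_minimal_of_isWalrasian hv_gs hr hq (hC.of_mem_demand_orValuation hr hS hA) hA.1.1
      (M.isOutcome r hr S).minimal_price
  have hfree : ∀ S ∈ demand (orValuation v) r, ∀ A, IsOptimalORAllocation v S A →
      EnvyFree v Finset.univ (M.price r S) A := fun S hS A hA => by
    rw [hprice S hS]
    exact (hC.of_mem_demand_orValuation hr hS hA).envyFree
  have halloc_free : ∀ S ∈ demand (orValuation v) r,
      EnvyFree v Finset.univ (M.price r S) (M.alloc r S) := fun S hS => by
    obtain ⟨A, hA⟩ := exists_isOptimalORAllocation v S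
    exact (hfree S hS A hA).to_univ hA.1.1 (M.isOutcome r hr S).envyFree
  have halloc : ∀ S ∈ demand (orValuation v) r,
      IsOptimalORAllocation v S (M.alloc r S) := fun S hS => by
    obtain ⟨A, hA⟩ := exists_isOptimalORAllocation v S
    have hout := M.isOutcome r hr S
    have h1 := hout.max_payment A ((hfree S hS A hA).of_univ hA.1.1)
    have h2 := hfree S hS A hA
    have h3 := halloc_free S hS
    rw [hprice S hS] at h1 h2 h3
    rw [hpay _ h2, hpay _ h3, hA.2] at h1
    exact ⟨hout.envyFree.1, le_antisymm (sum_le_orValuation hout.envyFree.1) (by linarith)⟩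
  have hrev : ∀ S ∈ demand (orValuation v) r, ∀ A, IsOptimalORAllocation v S A →
      outcomeRevenue v r S (M.price r S) A = utility (orValuation v) r S - U :=
    fun S hS A hA => by
    have h := hfree S hS A hA
    rw [outcomeRevenue, if_pos h, hprice S hS]
    rw [hprice S hS] at h
    rw [hpay A h, hA.2, utility]
    ring
  -- Nonnegativity separates these revenues from the penalty -1, so a set with the penalty is never
  -- demanded.
  have hrev_nonneg : ∀ S ∈ demand (orValuation v) r, 0 ≤ M.revenue r S := fun S hS => by
    rw [EFMediator.revenue, outcomeRevenue, if_pos (halloc_free S hS)]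
    exact sub_nonneg.2 (sum_reserve_le_of_mem_demand_orValuation
      (M.isOutcome r hr S).minimal_price.prop.1 hS (halloc S hS))
  have hrev_le : ∀ T, M.revenue r T = -1 ∨
      M.revenue r T ≤ utility (orValuation v) r T - U := fun T => by
    by_cases h : EnvyFree v Finset.univ (M.price r T) (M.alloc r T)
    · right
      have hout := M.isOutcome r hr T
      have hpq := eq_of_isVirtualAuctionOutcome hv_gs hr hq hC hout h
      rw [EFMediator.revenue, outcomeRevenue, if_pos h, hpq]
      rw [hpq] at h
      rw [hpay _ h, utility]
      linarith [sum_le_orValuation (v := v) hout.envyFree.1]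
    · left
      rw [EFMediator.revenue, outcomeRevenue, if_neg h]
  have hdemand : M.demand r = demand (orValuation v) r := by
    ext S
    constructor
    · intro hS
      obtain ⟨S₀, hS₀⟩ := exists_utility_eq_maxUtility (orValuation v) r
      have hS₀ := mem_demand_iff_eq_maxUtility.2 hS₀
      have h1 : M.revenue r S₀ ≤ M.revenue r S := hS S₀
      have h2 : M.revenue r S₀ = _ := hrev S₀ hS₀ _ (halloc S₀ hS₀)
      have h3 := hrev_nonneg S₀ hS₀
      refine mem_demand.2 fun T => (mem_demand.1 hS₀ T).trans ?_
      rcases hrev_le S with h | h <;> linarith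
    · intro hS T
      have h1 : M.revenue r S = _ := hrev S hS _ (halloc S hS)
      have h2 := hrev_nonneg S hS
      have h3 := mem_demand.1 hS T
      rcases hrev_le T with h | h <;> linarith
  refine ⟨hdemand, fun S hS => ?_⟩
  rw [hdemand] at hS
  have hout := M.isOutcome r hr S
  refine ⟨halloc S hS, fun A hA => ⟨⟨hout.minimal_price, (hfree S hS A hA).of_univ hA.1.1,
    fun A' hA' => ?_⟩, hfree S hS A hA, ?_⟩⟩
  · have h1 := hfree S hS A hA
    have h2 := h1.to_univ hA.1.1 hA'
    rw [hprice S hS] at h1 h2 ⊢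
    rw [hpay _ h1, hpay _ h2, hA.2]
    linarith [sum_le_orValuation (v := v) hA'.1]
  · rw [hrev S hS A hA]
    exact (hrev S hS _ (halloc S hS)).symm
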